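/- **Conventions.** A composition $\alpha=(\alpha_1,\dots,\alpha_k)$ of $n\ge 0$ (written $\alpha\vDash n$) is a finite sequence of positive integers with sum $n$. Its reverse composition diagram has $\alpha_i$ left-justified cells in row $i$ from the top; $(i,j)$ denotes the cell in row $i$ and column $j$. A standard reverse composition tableau (SRCT) of shape $\alpha$ is a bijective filling $\tau$ of the cells by $1,\dots,n$ such that the rows decrease from left to right, the first column increases from top to bottom, and, whenever $i<j$, the cells $(i,k)$ and $(j,k+1)$ exist and $\tau(i,k)>\tau(j,k+1)$, the cell $(i,k+1)$ exists and $\tau(i,k+1)>\tau(j,k+1)$. The $0$-Hecke algebra $H_n(0)$ is the unital associative $\mathbb C$-algebra generated by $T_1,\dots,T_{n-1}$ with relations $T_i^2=T_i$, $T_iT_{i+1}T_i=T_{i+1}T_iT_{i+1}$, and $T_iT_j=T_jT_i$ for $|i-j|\ge 2$ (so $H_0(0)=H_1(0)=\mathbb C$). For $\alpha\vDash n$, let $\mathbf S_\alpha$ be the $\mathbb C$-vector space with basis the SRCTs of shape $\alpha$, on which $T_i$ acts by the operator $\pi_i$ defined as follows. - If $i+1$ lies in a column strictly left of the column of $i$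 in $\tau$, then $\pi_i(\tau)=\tau$. - If $i$ and $i+1$ lie in the same column, or $i+1$ lies in the column immediately to the right of that of $i$ and in a strictly lower row, then $\pi_i(\tau)=0$. - Otherwise $\pi_i(\tau)$ is the tableau obtained from $\tau$ by interchanging $i$ and $i+1$. These operators make $\mathbf S_\alpha$ a left $H_n(0)$-module. For $n\ge1$, regard $H_{n-1}(0)$ as the subalgebra of $H_n(0)$ generated by $T_2,\dots,T_{n-1}$, via $T_i\mapsto T_{i+1}$. A part $\alpha_i$ of $\alpha$ has a removable node if $i=1$, or if $i\ge 2$, $\alpha_i\ge2$ and no $j<i$ satisfies $\alpha_j=\alpha_i-1$; the removable node is then the last cell of row $i$. Removing it replaces $\alpha_i$ by $\alpha_i-1$, and deletes the part if it becomes $0$. **Corollary 9.10 (Branching rule).** Let $n\ge 1$ and $\alpha\vDash n$. Then there is an isomorphism of $H_{n-1}(0)$-modules $$\mathbf S_\alpha\big\downarrow^{H_n(0)}_{H_{n-1}(0)}\;\cong\;\bigoplus_{\alpha^-}\mathbf S_{\alpha^-},$$ where $\alpha^-$ runs over the compositions of $n-1$ obtained from $\alpha$ by removing a removable node. -/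

import Mathlib

/-- The defining relations of the `0`-Hecke algebra `H_n(0)`.  The generators are indexed from `0`:
the index `i : Fin (n - 1)` stands for the generator usually written `T_{i+1}`. -/
inductive HeckeZero.Rel (n : ℕ) :
    FreeAlgebra ℂ (Fin (n - 1)) → FreeAlgebra ℂ (Fin (n - 1)) → Prop
  | idem (i : Fin (n - 1)) :
      HeckeZero.Rel n (FreeAlgebra.ι ℂ i * FreeAlgebra.ι ℂ i) (FreeAlgebra.ι ℂ i)
  | braid (i j : Fin (n - 1)) (h : j.val = i.val + 1) :
      HeckeZero.Rel n (FreeAlgebra.ι ℂ i * FreeAlgebra.ι ℂ j * FreeAlgebra.ι ℂ i)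
        (FreeAlgebra.ι ℂ j * FreeAlgebra.ι ℂ i * FreeAlgebra.ι ℂ j)
  | comm (i j : Fin (n - 1)) (h : i.val + 2 ≤ j.val) :
      HeckeZero.Rel n (FreeAlgebra.ι ℂ i * FreeAlgebra.ι ℂ j)
        (FreeAlgebra.ι ℂ j * FreeAlgebra.ι ℂ i)

/-- The `0`-Hecke algebra `H_n(0)` over `ℂ`, by generators and relations. -/
abbrev HeckeZero (n : ℕ) : Type := RingQuot (HeckeZero.Rel n)

namespace HeckeZero

/-- The generators of `H_n(0)`. -/
noncomputable def T {n : ℕ} (i : Fin (n - 1)) : HeckeZero n :=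
  RingQuot.mkAlgHom ℂ (HeckeZero.Rel n) (FreeAlgebra.ι ℂ i)

/-- The universal property of `H_n(0)`: elements of an algebra which satisfy the defining
relations give an algebra homomorphism. -/
noncomputable def lift {n : ℕ} {A : Type*} [Semiring A] [Algebra ℂ A] (f : Fin (n - 1) → A)
    (h1 : ∀ i, f i * f i = f i)
    (h2 : ∀ i j : Fin (n - 1), j.val = i.val + 1 → f i * f j * f i = f j * f i * f j)
    (h3 : ∀ i j : Fin (n - 1), i.val + 2 ≤ j.val → f i * f j = f j * f i) :
    HeckeZero n →ₐ[ℂ] A :=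
  RingQuot.liftAlgHom ℂ ⟨FreeAlgebra.lift ℂ f, by
    intro x y hxy
    cases hxy with
    | idem i => simpa using h1 i
    | braid i j h => simpa using h2 i j h
    | comm i j h => simpa using h3 i j h⟩

theorem lift_T {n : ℕ} {A : Type*} [Semiring A] [Algebra ℂ A] (f : Fin (n - 1) → A) (h1 h2 h3)
    (i : Fin (n - 1)) : lift f h1 h2 h3 (T i) = f i := by
  simp [lift, T]

theorem T_idem {n : ℕ} (i : Fin (n - 1)) : (T i * T i : HeckeZero n) = T i := by
  simpa [T] using RingQuot.mkAlgHom_rel ℂ (HeckeZero.Rel.idem (n := n) i)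

theorem T_braid {n : ℕ} (i j : Fin (n - 1)) (h : j.val = i.val + 1) :
    (T i * T j * T i : HeckeZero n) = T j * T i * T j := by
  simpa [T] using RingQuot.mkAlgHom_rel ℂ (HeckeZero.Rel.braid (n := n) i j h)

theorem T_comm {n : ℕ} (i j : Fin (n - 1)) (h : i.val + 2 ≤ j.val) :
    (T i * T j : HeckeZero n) = T j * T i := by
  simpa [T] using RingQuot.mkAlgHom_rel ℂ (HeckeZero.Rel.comm (n := n) i j h)

/-- The inclusion `H_n(0) = H_1(0) ⊗ H_n(0) ≅ H_{1,n}(0) ⊆ H_{n+1}(0)`, `T_i ↦ T_{i+1}`. -/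
noncomputable def shift (n : ℕ) : HeckeZero n →ₐ[ℂ] HeckeZero (n + 1) :=
  lift (fun i => T ⟨i.val + 1, by omega⟩)
    (fun _ => T_idem _)
    (fun _ _ h => T_braid _ _ (by simp [h]))
    (fun _ _ h => T_comm _ _ (by simp only; omega))

theorem shift_T {n : ℕ} (i : Fin (n - 1)) :
    shift n (T i) = T (n := n + 1) ⟨i.val + 1, by omega⟩ :=
  lift_T _ _ _ _ i

/-- `shift` is injective, so that `H_n(0)` is indeed a subalgebra of `H_{n+1}(0)`: sending `T_1`
to `1` and `T_{i+1}` to `T_i` is a retraction. -/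
theorem shift_injective (n : ℕ) : Function.Injective (shift n) := by
  let f : Fin (n + 1 - 1) → HeckeZero n := fun i =>
    if h : i.val = 0 then 1 else T ⟨i.val - 1, by omega⟩
  let r : HeckeZero (n + 1) →ₐ[ℂ] HeckeZero n := lift f
    (by
      intro i
      by_cases h : i.val = 0
      · simp [f, h]
      · simp [f, h, T_idem])
    (by
      intro i j hij
      have hj : j.val ≠ 0 := by omega
      by_cases h : i.val = 0
      · simp [f, h, hj, T_idem]
      · simp only [f, h, hj, dite_false]
        exact T_braid _ _ (by simp only; omega))
    (by
      intro i j hij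
      have hj : j.val ≠ 0 := by omega
      by_cases h : i.val = 0
      · simp [f, h]
      · simp only [f, h, hj, dite_false]
        exact T_comm _ _ (by simp only; omega))
  have hr : r.comp (shift n) = AlgHom.id ℂ (HeckeZero n) := by
    apply RingQuot.ringQuot_ext'
    apply FreeAlgebra.hom_ext
    funext i
    change r (shift n (T i)) = T i
    rw [shift_T, lift_T]
    simp [f]
  intro x y hxy
  have := congrArg r hxy
  have e : ∀ z, r (shift n z) = z := fun z => DFunLike.congr_fun hr z
  rwa [e, e] at this

end HeckeZero

/-- The cells of the reverse composition diagram of `α`: the pair `⟨i, j⟩` is the cell in the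
`(i+1)`-st row from the top and the `(j+1)`-st column from the left. -/
abbrev CompCell {n : ℕ} (α : Composition n) : Type := Σ i : Fin α.length, Fin (α.blocksFun i)

/-- Standard reverse composition tableaux of shape `α`.  A filling by `1, …, n` is recorded as a
bijection onto `Fin n`; the value `v : Fin n` stands for the entry `v + 1`. -/
@[ext]
structure SRCT {n : ℕ} (α : Composition n) where
  /-- the filling -/
  entry : CompCell α ≃ Fin n
  /-- the rows decrease from left to right -/
  row_decreasing : ∀ (i : Fin α.length) (a b : Fin (α.blocksFun i)), a < b →
    entry ⟨i, b⟩ < entry ⟨i, a⟩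
  /-- the first column increases from top to bottom -/
  first_col_increasing : ∀ (i j : Fin α.length) (a : Fin (α.blocksFun i))
    (b : Fin (α.blocksFun j)), i < j → a.val = 0 → b.val = 0 → entry ⟨i, a⟩ < entry ⟨j, b⟩
  /-- the triple rule: `a = k` and `b = k + 1` are the columns -/
  triple : ∀ (i j : Fin α.length) (a : Fin (α.blocksFun i)) (b : Fin (α.blocksFun j)),
    i < j → b.val = a.val + 1 → entry ⟨j, b⟩ < entry ⟨i, a⟩ →
      ∃ c : Fin (α.blocksFun i), c.val = a.val + 1 ∧ entry ⟨j, b⟩ < entry ⟨i, c⟩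

namespace SRCT

variable {n : ℕ} {α : Composition n}

/-- The row (from `0`) of the entry `v`. -/
def row (τ : SRCT α) (v : Fin n) : ℕ := (τ.entry.symm v).1.val

/-- The column (from `0`) of the entry `v`. -/
def col (τ : SRCT α) (v : Fin n) : ℕ := (τ.entry.symm v).2.val

/-- The smaller one of the two values which the index `i` of a generator refers to. -/
def lo (i : Fin (n - 1)) : Fin n := ⟨i.val, by omega⟩

/-- The larger one of the two values which the index `i` of a generator refers to. -/
def hi (i : Fin (n - 1)) : Fin n := ⟨i.val + 1, by omega⟩

/-- `i` is a descent: `i + 1` appears weakly right of `i`. -/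
def IsDescent (τ : SRCT α) (i : Fin (n - 1)) : Prop := τ.col (lo i) ≤ τ.col (hi i)

/-- `i` and `i + 1` are attacking: they are in the same column, or they are in adjacent columns
with `i + 1` strictly southeast of `i`. -/
def Attacking (τ : SRCT α) (i : Fin (n - 1)) : Prop :=
  τ.col (lo i) = τ.col (hi i) ∨
    (τ.col (hi i) = τ.col (lo i) + 1 ∧ τ.row (lo i) < τ.row (hi i))

theorem row_entry (τ : SRCT α) (c : CompCell α) : τ.row (τ.entry c) = c.1.val := by
  simp [row]

theorem col_entry (τ : SRCT α) (c : CompCell α) : τ.col (τ.entry c) = c.2.val := by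
  unfold col
  rw [Equiv.symm_apply_apply]

theorem swap_lt_swap {i : Fin (n - 1)} {u v : Fin n} (h : u < v)
    (hne : ¬ (u = lo i ∧ v = hi i)) :
    Equiv.swap (lo i) (hi i) u < Equiv.swap (lo i) (hi i) v := by
  rw [Equiv.swap_apply_def, Equiv.swap_apply_def]
  simp only [lo, hi, Fin.ext_iff, Fin.lt_def] at *
  split_ifs <;> simp_all <;> omega

/-- For a non-attacking descent `i`, the tableau `s_i(τ)` obtained by interchanging the entries
`i` and `i + 1`. -/
def flip (τ : SRCT α) (i : Fin (n - 1)) (hd : τ.IsDescent i) (ha : ¬ τ.Attacking i) : SRCT α where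
  entry := τ.entry.trans (Equiv.swap (lo i) (hi i))
  row_decreasing := by
    intro r a b hab
    refine swap_lt_swap (τ.row_decreasing r a b hab) ?_
    rintro ⟨h1, h2⟩
    have h3 : τ.col (lo i) = b.val := by rw [← h1, col_entry]
    have h4 : τ.col (hi i) = a.val := by rw [← h2, col_entry]
    unfold IsDescent at hd
    rw [Fin.lt_def] at hab
    omega
  first_col_increasing := by
    intro r s a b hrs h0 h0'
    refine swap_lt_swap (τ.first_col_increasing r s a b hrs h0 h0') ?_
    rintro ⟨h1, h2⟩
    have h3 : τ.col (lo i) = a.val := by rw [← h1, col_entry]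
    have h4 : τ.col (hi i) = b.val := by rw [← h2, col_entry]
    exact ha (Or.inl (by omega))
  triple := by
    intro r s a b hrs hab hlt
    have key : τ.entry ⟨s, b⟩ < τ.entry ⟨r, a⟩ := by
      have hlt' := swap_lt_swap (i := i) hlt (by
        rintro ⟨h1, h2⟩
        simp only [Equiv.trans_apply] at h1 h2
        rw [Equiv.swap_apply_eq_iff, Equiv.swap_apply_left] at h1
        rw [Equiv.swap_apply_eq_iff, Equiv.swap_apply_right] at h2
        apply ha
        right
        rw [← h1, ← h2, col_entry, col_entry, row_entry, row_entry]
        exact ⟨hab, hrs⟩)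
      simpa using hlt'
    obtain ⟨c, hc, hlt'⟩ := τ.triple r s a b hrs hab key
    refine ⟨c, hc, swap_lt_swap hlt' ?_⟩
    rintro ⟨h1, h2⟩
    have h3 : τ.col (lo i) = b.val := by rw [← h1, col_entry]
    have h4 : τ.col (hi i) = c.val := by rw [← h2, col_entry]
    exact ha (Or.inl (by omega))

open Classical in
/-- The vector `π_i(τ)`. -/
noncomputable def piVec (i : Fin (n - 1)) (τ : SRCT α) : SRCT α →₀ ℂ :=
  if hd : τ.IsDescent i then
    if ha : τ.Attacking i then 0
    else Finsupp.single (τ.flip i hd ha) 1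
  else Finsupp.single τ 1

/-- The operator `π_i` on the `ℂ`-linear span of the tableaux of shape `α`. -/
noncomputable def piOp (α : Composition n) (i : Fin (n - 1)) : Module.End ℂ (SRCT α →₀ ℂ) :=
  Finsupp.linearCombination ℂ (piVec i)

theorem piOp_single (i : Fin (n - 1)) (τ : SRCT α) :
    piOp α i (Finsupp.single τ 1) = piVec i τ := by
  simp [piOp]

theorem piOp_of_lt {i : Fin (n - 1)} {τ : SRCT α} (h : τ.col (hi i) < τ.col (lo i)) :
    piOp α i (Finsupp.single τ 1) = Finsupp.single τ 1 := by
  have h' : ¬ τ.IsDescent i := by unfold IsDescent; omega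
  simp [piOp_single, piVec, h']

theorem piOp_of_attacking {i : Fin (n - 1)} {τ : SRCT α} (ha : τ.Attacking i) :
    piOp α i (Finsupp.single τ 1) = 0 := by
  have h' : τ.IsDescent i := by unfold Attacking at ha; unfold IsDescent; omega
  simp [piOp_single, piVec, h', ha]

theorem piOp_of_flip {i : Fin (n - 1)} {τ : SRCT α} (h : τ.IsDescent i)
    (ha : ¬ τ.Attacking i) :
    piOp α i (Finsupp.single τ 1) = Finsupp.single (τ.flip i h ha) 1 := by
  simp [piOp_single, piVec, h, ha]

theorem col_of_entry_eq {τ σ : SRCT α} {u v : Fin n}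
    (h : σ.entry = τ.entry.trans (Equiv.swap u v)) (w : Fin n) :
    σ.col w = τ.col (Equiv.swap u v w) := by
  unfold col
  rw [h]
  rfl

theorem row_of_entry_eq {τ σ : SRCT α} {u v : Fin n}
    (h : σ.entry = τ.entry.trans (Equiv.swap u v)) (w : Fin n) :
    σ.row w = τ.row (Equiv.swap u v w) := by
  simp [row, h]

theorem piOp_cases (i : Fin (n - 1)) (τ : SRCT α) :
    (τ.col (hi i) < τ.col (lo i) ∧ piOp α i (Finsupp.single τ 1) = Finsupp.single τ 1) ∨
    (τ.Attacking i ∧ piOp α i (Finsupp.single τ 1) = 0) ∨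
    (τ.col (lo i) < τ.col (hi i) ∧ ¬ τ.Attacking i ∧ ∃ σ : SRCT α,
      σ.entry = τ.entry.trans (Equiv.swap (lo i) (hi i)) ∧
      piOp α i (Finsupp.single τ 1) = Finsupp.single σ 1) := by
  by_cases hd : τ.IsDescent i
  · by_cases ha : τ.Attacking i
    · exact Or.inr (Or.inl ⟨ha, piOp_of_attacking ha⟩)
    · refine Or.inr (Or.inr ⟨?_, ha, _, rfl, piOp_of_flip hd ha⟩)
      unfold IsDescent at hd
      unfold Attacking at ha
      omega
  · have : τ.col (hi i) < τ.col (lo i) := by unfold IsDescent at hd; omega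
    exact Or.inl ⟨this, piOp_of_lt this⟩

theorem piOp_idem (i : Fin (n - 1)) : piOp α i * piOp α i = piOp α i := by
  refine Finsupp.lhom_ext' fun τ => LinearMap.ext_ring ?_
  simp only [LinearMap.comp_apply, Finsupp.lsingle_apply]
  rw [Module.End.mul_apply]
  rcases piOp_cases i τ with ⟨_, h⟩ | ⟨_, h⟩ | ⟨hlt, _, σ, hσ, h⟩
  · rw [h, h]
  · rw [h, map_zero]
  · rw [h, piOp_of_lt]
    rw [col_of_entry_eq hσ, col_of_entry_eq hσ, Equiv.swap_apply_left, Equiv.swap_apply_right]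
    exact hlt

theorem piOp_comm (i j : Fin (n - 1)) (hij : i.val + 2 ≤ j.val) :
    piOp α i * piOp α j = piOp α j * piOp α i := by
  have e1 : lo i ≠ lo j := by simp [lo, Fin.ext_iff]; omega
  have e2 : lo i ≠ hi j := by simp [lo, hi, Fin.ext_iff]; omega
  have e3 : hi i ≠ lo j := by simp [lo, hi, Fin.ext_iff]; omega
  have e4 : hi i ≠ hi j := by simp [hi, Fin.ext_iff]; omega
  refine Finsupp.lhom_ext' fun τ => LinearMap.ext_ring ?_
  simp only [LinearMap.comp_apply, Finsupp.lsingle_apply]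
  rw [Module.End.mul_apply, Module.End.mul_apply]
  have A : ∀ σ : SRCT α, σ.entry = τ.entry.trans (Equiv.swap (lo i) (hi i)) →
      σ.col (lo j) = τ.col (lo j) ∧ σ.col (hi j) = τ.col (hi j) ∧
      σ.row (lo j) = τ.row (lo j) ∧ σ.row (hi j) = τ.row (hi j) := by
    intro σ hσ
    simp only [col_of_entry_eq hσ, row_of_entry_eq hσ,
      Equiv.swap_apply_of_ne_of_ne e1.symm e3.symm, Equiv.swap_apply_of_ne_of_ne e2.symm e4.symm,
      and_self]
  have B : ∀ σ : SRCT α, σ.entry = τ.entry.trans (Equiv.swap (lo j) (hi j)) →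
      σ.col (lo i) = τ.col (lo i) ∧ σ.col (hi i) = τ.col (hi i) ∧
      σ.row (lo i) = τ.row (lo i) ∧ σ.row (hi i) = τ.row (hi i) := by
    intro σ hσ
    simp only [col_of_entry_eq hσ, row_of_entry_eq hσ,
      Equiv.swap_apply_of_ne_of_ne e1 e2, Equiv.swap_apply_of_ne_of_ne e3 e4, and_self]
  rcases piOp_cases i τ with ⟨hi1, hi2⟩ | ⟨hi1, hi2⟩ | ⟨hi1, hi3, σ, hσ, hi2⟩ <;>
  rcases piOp_cases j τ with ⟨hj1, hj2⟩ | ⟨hj1, hj2⟩ | ⟨hj1, hj3, ρ, hρ, hj2⟩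
  · rw [hi2, hj2, hi2]
  · rw [hi2, hj2, map_zero]
  · obtain ⟨a1, a2, a3, a4⟩ := B ρ hρ
    rw [hi2, hj2, piOp_of_lt (by omega)]
  · rw [hi2, hj2, hi2, map_zero]
  · rw [hi2, hj2, map_zero, map_zero]
  · obtain ⟨a1, a2, a3, a4⟩ := B ρ hρ
    rw [hi2, hj2, map_zero, piOp_of_attacking (by unfold Attacking at *; omega)]
  · obtain ⟨a1, a2, a3, a4⟩ := A σ hσ
    rw [hi2, hj2, hi2, piOp_of_lt (by omega)]
  · obtain ⟨a1, a2, a3, a4⟩ := A σ hσ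
    rw [hi2, hj2, map_zero, piOp_of_attacking (by unfold Attacking at *; omega)]
  · obtain ⟨a1, a2, a3, a4⟩ := A σ hσ
    obtain ⟨b1, b2, b3, b4⟩ := B ρ hρ
    rw [hi2, hj2, piOp_of_flip (by unfold IsDescent; omega) (by unfold Attacking at *; omega),
      piOp_of_flip (by unfold IsDescent; omega) (by unfold Attacking at *; omega)]
    congr 1
    apply SRCT.ext
    simp only [flip, hσ, hρ]
    ext c
    simp only [Equiv.trans_apply, Equiv.swap_apply_def]
    split_ifs <;> simp_all

theorem piOp_braid (i j : Fin (n - 1)) (hij : j.val = i.val + 1) :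
    piOp α i * piOp α j * piOp α i = piOp α j * piOp α i * piOp α j := by
  have e : lo j = hi i := by simp [lo, hi, hij]
  have e1 : lo i ≠ hi i := by simp [lo, hi, Fin.ext_iff]
  have e2 : lo i ≠ hi j := by simp [lo, hi, Fin.ext_iff]; omega
  have e3 : hi i ≠ hi j := by simp [hi, Fin.ext_iff]; omega
  refine Finsupp.lhom_ext' fun τ => LinearMap.ext_ring ?_
  simp only [LinearMap.comp_apply, Finsupp.lsingle_apply]
  simp only [Module.End.mul_apply]
  have A : ∀ τ σ : SRCT α, σ.entry = τ.entry.trans (Equiv.swap (lo i) (hi i)) →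
      (σ.col (lo i) = τ.col (hi i) ∧ σ.col (hi i) = τ.col (lo i) ∧ σ.col (hi j) = τ.col (hi j)) ∧
      (σ.row (lo i) = τ.row (hi i) ∧ σ.row (hi i) = τ.row (lo i) ∧
        σ.row (hi j) = τ.row (hi j)) := by
    intro τ σ hσ
    simp only [col_of_entry_eq hσ, row_of_entry_eq hσ, Equiv.swap_apply_left,
      Equiv.swap_apply_right, Equiv.swap_apply_of_ne_of_ne e2.symm e3.symm, and_self]
  have B : ∀ τ σ : SRCT α, σ.entry = τ.entry.trans (Equiv.swap (hi i) (hi j)) →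
      (σ.col (lo i) = τ.col (lo i) ∧ σ.col (hi i) = τ.col (hi j) ∧ σ.col (hi j) = τ.col (hi i)) ∧
      (σ.row (lo i) = τ.row (lo i) ∧ σ.row (hi i) = τ.row (hi j) ∧
        σ.row (hi j) = τ.row (hi i)) := by
    intro τ σ hσ
    simp only [col_of_entry_eq hσ, row_of_entry_eq hσ, Equiv.swap_apply_left,
      Equiv.swap_apply_right, Equiv.swap_apply_of_ne_of_ne e1 e2, and_self]
  have C := fun τ : SRCT α => piOp_cases i τ
  have D := fun τ : SRCT α => piOp_cases j τ
  have L := fun (τ : SRCT α) => piOp_of_lt (i := j) (τ := τ)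
  have K := fun (τ : SRCT α) => piOp_of_attacking (i := j) (τ := τ)
  unfold Attacking at C D K
  simp only [e] at D L K
  rcases C τ with ⟨hi1, hi2⟩ | ⟨hi1, hi2⟩ | ⟨hi1, hi3, σ, hσ, hi2⟩ <;>
  rcases D τ with ⟨hj1, hj2⟩ | ⟨hj1, hj2⟩ | ⟨hj1, hj3, ρ, hρ, hj2⟩
  · rw [hi2, hj2, hi2, hj2]
  · rw [hi2, hj2, map_zero, map_zero]
  · obtain ⟨⟨a1, a2, a3⟩, a4, a5, a6⟩ := B τ ρ hρ
    rw [hi2, hj2]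
    rcases C ρ with ⟨k1, k2⟩ | ⟨k1, k2⟩ | ⟨k1, k3, μ, hμ, k2⟩
    · rw [k2, L _ (by omega)]
    · rw [k2, map_zero]
    · obtain ⟨⟨b1, b2, b3⟩, b4, b5, b6⟩ := A ρ μ hμ
      rw [k2, L _ (by omega)]
  · rw [hi2, hj2, hi2, map_zero, map_zero]
  · rw [hi2, hj2, map_zero, map_zero, map_zero]
  · obtain ⟨⟨a1, a2, a3⟩, a4, a5, a6⟩ := B τ ρ hρ
    rw [hi2, hj2, map_zero, map_zero]
    rcases C ρ with ⟨k1, k2⟩ | ⟨k1, k2⟩ | ⟨k1, k3, μ, hμ, k2⟩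
    · omega
    · rw [k2, map_zero]
    · obtain ⟨⟨b1, b2, b3⟩, b4, b5, b6⟩ := A ρ μ hμ
      rw [k2, K _ (by omega)]
  · obtain ⟨⟨a1, a2, a3⟩, a4, a5, a6⟩ := A τ σ hσ
    rw [hi2, hj2, hi2]
    rcases D σ with ⟨k1, k2⟩ | ⟨k1, k2⟩ | ⟨k1, k3, μ, hμ, k2⟩
    · rw [k2, piOp_of_lt (by omega)]
    · rw [k2, map_zero]
    · obtain ⟨⟨b1, b2, b3⟩, b4, b5, b6⟩ := B σ μ hμ
      rw [k2, piOp_of_lt (by omega)]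
  · obtain ⟨⟨a1, a2, a3⟩, a4, a5, a6⟩ := A τ σ hσ
    rw [hi2, hj2, map_zero, map_zero]
    rcases D σ with ⟨k1, k2⟩ | ⟨k1, k2⟩ | ⟨k1, k3, μ, hμ, k2⟩
    · omega
    · rw [k2, map_zero]
    · obtain ⟨⟨b1, b2, b3⟩, b4, b5, b6⟩ := B σ μ hμ
      rw [k2, piOp_of_attacking (by unfold Attacking; omega)]
  · obtain ⟨⟨a1, a2, a3⟩, a4, a5, a6⟩ := A τ σ hσ
    obtain ⟨⟨b1, b2, b3⟩, b4, b5, b6⟩ := B τ ρ hρ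
    rw [hi2, hj2]
    rcases D σ with ⟨k1, k2⟩ | ⟨k1, k2⟩ | ⟨k1, k3, μ, hμ, k2⟩
    · omega
    · omega
    rcases C ρ with ⟨l1, l2⟩ | ⟨l1, l2⟩ | ⟨l1, l3, ν, hν, l2⟩
    · omega
    · omega
    obtain ⟨⟨c1, c2, c3⟩, c4, c5, c6⟩ := B σ μ hμ
    obtain ⟨⟨d1, d2, d3⟩, d4, d5, d6⟩ := A ρ ν hν
    rw [k2, l2, piOp_of_flip (by unfold IsDescent; omega) (by unfold Attacking; omega),
      piOp_of_flip (by unfold IsDescent; rw [e]; omega) (by unfold Attacking; rw [e]; omega)]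
    congr 1
    apply SRCT.ext
    simp only [flip, hσ, hρ, hμ, hν, e, Equiv.trans_assoc]
    have h1 := Equiv.swap_mul_swap_mul_swap e1 e2
    have h2 := Equiv.swap_mul_swap_mul_swap e3.symm e2.symm
    rw [Equiv.swap_comm (hi j) (hi i), Equiv.swap_comm (hi i) (lo i)] at h2
    congr 1
    ext c : 1
    have h3 := DFunLike.congr_fun (h2.trans (Equiv.swap_comm _ _)) c
    have h4 := DFunLike.congr_fun h1 c
    simp only [Equiv.Perm.mul_apply] at h3 h4
    simp only [Equiv.trans_apply]
    rw [h3, ← h4]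

/-- The representation of `H_n(0)` in which the generators act by the operators `π_i`. -/
noncomputable def rep (α : Composition n) : HeckeZero n →ₐ[ℂ] Module.End ℂ (SRCT α →₀ ℂ) :=
  HeckeZero.lift (piOp α) piOp_idem piOp_braid piOp_comm

end SRCT

/-- The vector space underlying the `H_n(0)`-module `S_α`: the `ℂ`-linear span of all standard
reverse composition tableaux of shape `α`. -/
def QSchurModule {n : ℕ} (α : Composition n) : Type := SRCT α →₀ ℂ

noncomputable instance {n : ℕ} (α : Composition n) : AddCommGroup (QSchurModule α) :=
  inferInstanceAs (AddCommGroup (SRCT α →₀ ℂ))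

noncomputable instance {n : ℕ} (α : Composition n) : Module ℂ (QSchurModule α) :=
  inferInstanceAs (Module ℂ (SRCT α →₀ ℂ))

/-- `H_n(0)` acts on `S_α` by letting the generators act as the operators `π_i`. -/
noncomputable instance {n : ℕ} (α : Composition n) : Module (HeckeZero n) (QSchurModule α) :=
  Module.compHom (SRCT α →₀ ℂ) (SRCT.rep α).toRingHom

instance {n : ℕ} (α : Composition n) : IsScalarTower ℂ (HeckeZero n) (QSchurModule α) where
  smul_assoc c h x := by
    change SRCT.rep α (c • h) x = c • SRCT.rep α h x
    rw [map_smul]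
    rfl

theorem QSchurModule.T_smul {n : ℕ} (α : Composition n) (i : Fin (n - 1)) (τ : SRCT α) :
    (HeckeZero.T i : HeckeZero n) • (show QSchurModule α from Finsupp.single τ 1) = SRCT.piVec i τ := by
  change SRCT.rep α (HeckeZero.T i) (Finsupp.single τ 1) = _
  rw [SRCT.rep, HeckeZero.lift_T, SRCT.piOp_single]

/-- `S_α`, for `α` a composition of `n + 1`, viewed as a module over the subalgebra `H_n(0)` of
`H_{n+1}(0)`, which is embedded by `HeckeZero.shift`. -/
def QSchurModuleRes {n : ℕ} (α : Composition (n + 1)) : Type := QSchurModule α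

noncomputable instance {n : ℕ} (α : Composition (n + 1)) : AddCommGroup (QSchurModuleRes α) :=
  inferInstanceAs (AddCommGroup (QSchurModule α))

noncomputable instance {n : ℕ} (α : Composition (n + 1)) :
    Module (HeckeZero n) (QSchurModuleRes α) :=
  Module.compHom (QSchurModule α) (HeckeZero.shift n).toRingHom

/-- The part of `α` in row `i` (counted from `0`) has a removable node. -/
def HasRemovableNode {n : ℕ} (α : Composition n) (i : Fin α.length) : Prop :=
  i.val = 0 ∨ (2 ≤ α.blocksFun i ∧ ¬ ∃ j : Fin α.length, j < i ∧ α.blocksFun j = α.blocksFun i - 1)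

/-- The composition obtained from `α` by removing the last cell of row `i`.  If this leaves row `i`
without cells, then the row is deleted. -/
def removeLastCell {n : ℕ} (α : Composition (n + 1)) (i : Fin α.length) : Composition n where
  blocks := (α.blocks.set i.val (α.blocksFun i - 1)).filter (fun m => 0 < m)
  blocks_pos := by
    intro m hm
    simpa using (List.mem_filter.1 hm).2
  blocks_sum := by
    have key : ∀ l : List ℕ, (l.filter (fun m => 0 < m)).sum = l.sum := by
      intro l
      induction l with
      | nil => rfl
      | cons a l ih =>
        rcases Nat.eq_zero_or_pos a with h | h
        · simp [h, ih]
        · simp [h, ih]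
    have key2 : ∀ (l : List ℕ) (k : ℕ) (hk : k < l.length), 0 < l[k] →
        (l.set k (l[k] - 1)).sum + 1 = l.sum := by
      intro l
      induction l with
      | nil => intro k hk; simp at hk
      | cons a l ih =>
        intro k hk hpos
        cases k with
        | zero => simp at hpos ⊢; omega
        | succ k =>
          simp only [List.getElem_cons_succ] at hpos
          have := ih k (by simpa using hk) hpos
          simp only [List.set_cons_succ, List.getElem_cons_succ, List.sum_cons]
          omega
    rw [key]
    have h := key2 α.blocks i.val i.isLt (α.blocks_pos (List.getElem_mem _))
    have h' := α.blocks_sum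
    have e : α.blocksFun i = α.blocks[i.val]'i.isLt := rfl
    rw [e]
    omega

/-- `β` is one of the compositions `α⁻`, obtained from `α` by removing a removable node. -/
def IsNodeRemoval {n : ℕ} (α : Composition (n + 1)) (β : Composition n) : Prop :=
  ∃ i : Fin α.length, HasRemovableNode α i ∧ β = removeLastCell α i

/-! The restriction splits because the generators `T_2, …, T_{n-1}` never move the entry 1 (the
value `0` of `Fin (n + 1)`), so the tableaux with 1 in a prescribed cell span a submodule.

Rows decrease, so 1 sits at the end of its row. It can sit at the end of row `i` exactly when that
row has a removable node. For a row other than the top one, a part of size 1 would break the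
increase of the first column. A higher row `j` with `α_j = α_i - 1` would have to contain, by the
triple rule, a cell beyond its end. Conversely, when neither obstruction occurs, a cell containing 1
can be added to any tableau of shape `α⁻`, after raising all its entries by one (`extend`,
`exists_extend_eq`).

Deleting the cell with 1 preserves all columns and shifts all row indices by the same amount,
because only the top row can disappear. Descents and attacking pairs are therefore preserved, and
extension intertwines `π_j` with `π_{j+1}` (`piOp_extend`). Different removable nodes give different
compositions (`removeLastCell_inj`), so the summands may be indexed by the compositions `α⁻`
themselves. The basis of `S_α` is then the disjoint union of the bases of the summands
(`bijective_sigma_of_extension_maps`). -/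

section NodeRemoval

/-! ### Removing a node from a composition -/

variable {n : ℕ}

/-- The number of rows deleted when the last cell of row `i` is removed. -/
def deletedRows (α : Composition n) (i : Fin α.length) : ℕ :=
  if α.blocksFun i = 1 then 1 else 0

/-- Below the top row a removable node requires a part of size at least 2, so only the top row can
vanish. -/
theorem HasRemovableNode.eq_zero_of_deletedRows {α : Composition n} {i : Fin α.length}
    (h : HasRemovableNode α i) (hd : 0 < deletedRows α i) :
    i.val = 0 ∧ deletedRows α i = 1 ∧ α.blocksFun i = 1 := by
  unfold deletedRows at *
  split_ifs at hd ⊢ with h1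
  · refine ⟨h.resolve_right fun h2 => ?_, rfl, h1⟩
    omega
  · omega

/-- Since only the first part can become zero, filtering out zeros amounts to dropping an initial
segment. Row indices then change by the constant `deletedRows α i`. -/
theorem removeLastCell_blocks {α : Composition (n + 1)} {i : Fin α.length}
    (h : HasRemovableNode α i) :
    (removeLastCell α i).blocks =
      (α.blocks.set i.val (α.blocksFun i - 1)).drop (deletedRows α i) := by
  have hpos : 0 < α.blocksFun i := α.blocks_pos' _ _
  change List.filter _ _ = _
  unfold deletedRows
  split_ifs with h1
  · have h0 : i.val = 0 := h.resolve_right fun h2 => by omega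
    rw [h0, h1]
    have hp := fun m => α.blocks_pos (i := m)
    generalize α.blocks = l at hp
    cases l with
    | nil => simp
    | cons a l =>
      simpa using fun m hm => hp m (List.mem_cons_of_mem _ hm)
  · rw [List.drop_zero, List.filter_eq_self]
    intro m hm
    rcases List.mem_or_eq_of_mem_set hm with hm | rfl
    · simpa using α.blocks_pos hm
    · simp only [decide_eq_true_eq]; omega

theorem removeLastCell_length {α : Composition (n + 1)} {i : Fin α.length}
    (h : HasRemovableNode α i) :
    (removeLastCell α i).length + deletedRows α i = α.length := by
  have hi := i.isLt
  have h1 : deletedRows α i ≤ 1 := by unfold deletedRows; split_ifs <;> omega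
  have h2 : (removeLastCell α i).length = α.length - deletedRows α i := by
    unfold Composition.length
    rw [removeLastCell_blocks h]
    simp
  omega

theorem removeLastCell_blocksFun {α : Composition (n + 1)} {i : Fin α.length}
    (h : HasRemovableNode α i) (r : Fin (removeLastCell α i).length) (s : Fin α.length)
    (hs : s.val = r.val + deletedRows α i) :
    (removeLastCell α i).blocksFun r = if s = i then α.blocksFun i - 1 else α.blocksFun s := by
  unfold Composition.blocksFun
  simp only [List.get_eq_getElem]
  simp only [removeLastCell_blocks h, List.getElem_drop, List.getElem_set]
  simp only [Fin.ext_iff, hs, add_comm (deletedRows α i)]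
  split_ifs with h1 h2 h2
  · rfl
  · omega
  · omega
  · rfl

/-- The length reveals whether a row was deleted. If so, both rows are the top one; if not, the
`i`-th part has dropped by one on the left, hence also on the right, which forces `i = j`. -/
theorem removeLastCell_inj {α : Composition (n + 1)} {i j : Fin α.length}
    (hi : HasRemovableNode α i) (hj : HasRemovableNode α j)
    (h : removeLastCell α i = removeLastCell α j) : i = j := by
  have l1 := removeLastCell_length hi
  have l2 := removeLastCell_length hj
  have hd : deletedRows α i = deletedRows α j := by rw [h] at l1; omega
  have hpos : 0 < α.blocksFun i := α.blocks_pos' _ _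
  rcases Nat.eq_zero_or_pos (deletedRows α i) with h0 | h0
  · by_contra hne
    have e1 := removeLastCell_blocksFun hi ⟨i.val, by omega⟩ i (by simp [h0])
    have e2 := removeLastCell_blocksFun hj ⟨i.val, by omega⟩ i (by simp [← hd, h0])
    rw [if_pos rfl] at e1
    rw [if_neg hne] at e2
    have e3 : (removeLastCell α i).blocksFun ⟨i.val, by omega⟩ =
        (removeLastCell α j).blocksFun ⟨i.val, by omega⟩ := by
      unfold Composition.blocksFun
      simp only [List.get_eq_getElem, h]
    omega
  · have a := hi.eq_zero_of_deletedRows h0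
    have b := hj.eq_zero_of_deletedRows (hd ▸ h0)
    omega

/-! ### Cells before and after the removal -/

theorem CompCell.ext_val {α : Composition n} {c d : CompCell α} (h1 : c.1.val = d.1.val)
    (h2 : c.2.val = d.2.val) : c = d := by
  obtain ⟨r, a⟩ := c
  obtain ⟨s, b⟩ := d
  obtain rfl : r = s := Fin.ext h1
  obtain rfl : a = b := Fin.ext h2
  rfl

/-- The last cell of row `i`. -/
def lastCell (α : Composition n) (i : Fin α.length) : CompCell α :=
  ⟨i, ⟨α.blocksFun i - 1, Nat.sub_lt (α.blocks_pos' _ _) one_pos⟩⟩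

/-- The cells which remain when the last cell of row `i` is removed. -/
def remainingCell {α : Composition (n + 1)} {i : Fin α.length} (h : HasRemovableNode α i)
    (c : CompCell (removeLastCell α i)) : CompCell α :=
  ⟨⟨c.1.val + deletedRows α i, by have := removeLastCell_length h; omega⟩, ⟨c.2.val, by
    have := c.2.isLt
    have e := removeLastCell_blocksFun h c.1
      ⟨c.1.val + deletedRows α i, by have := removeLastCell_length h; omega⟩ rfl
    split_ifs at e with h1
    · rw [h1]; omega
    · omega⟩⟩

theorem remainingCell_ne_lastCell {α : Composition (n + 1)} {i : Fin α.length}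
    (h : HasRemovableNode α i) (c : CompCell (removeLastCell α i)) :
    remainingCell h c ≠ lastCell α i := by
  intro hc
  have h1 : (remainingCell h c).1 = i := congrArg Sigma.fst hc
  have h2 : (remainingCell h c).2.val = (lastCell α i).2.val := by rw [hc]
  have e := removeLastCell_blocksFun h c.1 (remainingCell h c).1 rfl
  rw [if_pos h1] at e
  have := c.2.isLt
  simp only [remainingCell, lastCell] at h2
  omega

theorem remainingCell_injective {α : Composition (n + 1)} {i : Fin α.length}
    (h : HasRemovableNode α i) : Function.Injective (remainingCell h) := by
  intro c d hcd
  have h1 : (remainingCell h c).1.val = (remainingCell h d).1.val := by rw [hcd]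
  have h2 : (remainingCell h c).2.val = (remainingCell h d).2.val := by rw [hcd]
  simp only [remainingCell] at h1 h2
  exact CompCell.ext_val (by omega) h2

theorem exists_remainingCell {α : Composition (n + 1)} {i : Fin α.length}
    (h : HasRemovableNode α i) {c : CompCell α} (hc : c ≠ lastCell α i) :
    ∃ d, remainingCell h d = c := by
  have hlen := removeLastCell_length h
  have ha := c.2.isLt
  have hr := c.1.isLt
  have hne : c.1 = i → c.2.val < α.blocksFun i - 1 := by
    rintro rfl
    have : c.2.val ≠ α.blocksFun c.1 - 1 := fun h2 => hc (CompCell.ext_val rfl h2)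
    omega
  -- If the top row is deleted, the removed cell was its only cell, so `c` lies lower and the
  -- subtraction of row indices below is not truncated.
  have hge : deletedRows α i ≤ c.1.val := by
    by_contra hlt
    obtain ⟨h0, h1, h2⟩ := h.eq_zero_of_deletedRows (by omega)
    have h3 : c.1 = i := Fin.ext (by omega)
    have := hne h3
    omega
  have e := removeLastCell_blocksFun h ⟨c.1.val - deletedRows α i, by omega⟩ c.1
    (by simp only; omega)
  refine ⟨⟨⟨c.1.val - deletedRows α i, by omega⟩, ⟨c.2.val, ?_⟩⟩,
    CompCell.ext_val (by simp only [remainingCell]; omega) rfl⟩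
  rw [e]
  split_ifs with h1
  · exact hne h1
  · exact ha

/-- The cells of `α` are the last cell of row `i` and the remaining cells. -/
noncomputable def optionCellEquiv {α : Composition (n + 1)} {i : Fin α.length}
    (h : HasRemovableNode α i) : Option (CompCell (removeLastCell α i)) ≃ CompCell α :=
  Equiv.ofBijective (fun o => o.elim (lastCell α i) (remainingCell h)) <| by
    constructor
    · rintro (_ | c) (_ | d) hcd
      · rfl
      · exact absurd hcd.symm (remainingCell_ne_lastCell h d)
      · exact absurd hcd (remainingCell_ne_lastCell h c)
      · exact congrArg some (remainingCell_injective h hcd)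
    · intro c
      by_cases hc : c = lastCell α i
      · exact ⟨none, hc.symm⟩
      · obtain ⟨d, hd⟩ := exists_remainingCell h hc
        exact ⟨some d, hd⟩

/-! ### Adding and deleting the smallest entry -/

namespace SRCT

/-- The filling of `α` with the smallest entry in the last cell of row `i`, in which the remaining
entries are arranged as in `σ`. -/
noncomputable def extendEntry {α : Composition (n + 1)} {i : Fin α.length}
    (h : HasRemovableNode α i) (e : CompCell (removeLastCell α i) ≃ Fin n) :
    CompCell α ≃ Fin (n + 1) :=
  (optionCellEquiv h).symm.trans (e.optionCongr.trans (finSuccEquiv n).symm)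

theorem extendEntry_lastCell {α : Composition (n + 1)} {i : Fin α.length}
    (h : HasRemovableNode α i) (e : CompCell (removeLastCell α i) ≃ Fin n) :
    extendEntry h e (lastCell α i) = 0 := by
  have : (optionCellEquiv h).symm (lastCell α i) = none := by
    rw [Equiv.symm_apply_eq]; rfl
  simp [extendEntry, this]

theorem extendEntry_remainingCell {α : Composition (n + 1)} {i : Fin α.length}
    (h : HasRemovableNode α i) (e : CompCell (removeLastCell α i) ≃ Fin n)
    (c : CompCell (removeLastCell α i)) :
    extendEntry h e (remainingCell h c) = (e c).succ := by
  have : (optionCellEquiv h).symm (remainingCell h c) = some c := by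
    rw [Equiv.symm_apply_eq]; rfl
  simp [extendEntry, this]

/-- The tableau of shape `α` obtained from `σ` by adding a cell with the smallest entry at the end
of row `i`. -/
noncomputable def extend {α : Composition (n + 1)} {i : Fin α.length}
    (h : HasRemovableNode α i) (σ : SRCT (removeLastCell α i)) : SRCT α where
  entry := extendEntry h σ.entry
  row_decreasing := by
    intro r a b hab
    by_cases hb : (⟨r, b⟩ : CompCell α) = lastCell α i
    · rw [hb, extendEntry_lastCell, Fin.pos_iff_ne_zero, ← extendEntry_lastCell h σ.entry,
        Ne, EmbeddingLike.apply_eq_iff_eq, ← hb]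
      intro hc
      simp only [Sigma.mk.injEq, heq_eq_eq, true_and] at hc
      omega
    have ha : (⟨r, a⟩ : CompCell α) ≠ lastCell α i := by
      intro ha
      have h1 : r = i := congrArg Sigma.fst ha
      subst h1
      have h2 : a.val = α.blocksFun r - 1 := by
        simp only [lastCell, Sigma.mk.injEq, heq_eq_eq, true_and] at ha
        rw [ha]
      omega
    obtain ⟨⟨r', a'⟩, hc⟩ := exists_remainingCell h ha
    obtain ⟨⟨s', b'⟩, hd⟩ := exists_remainingCell h hb
    rw [← hc, ← hd, extendEntry_remainingCell, extendEntry_remainingCell, Fin.succ_lt_succ_iff]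
    have h1 : (remainingCell h ⟨r', a'⟩).1.val = r.val := by rw [hc]
    have h2 : (remainingCell h ⟨s', b'⟩).1.val = r.val := by rw [hd]
    have h3 : (remainingCell h ⟨r', a'⟩).2.val = a.val := by rw [hc]
    have h4 : (remainingCell h ⟨s', b'⟩).2.val = b.val := by rw [hd]
    simp only [remainingCell] at h1 h2 h3 h4
    obtain rfl : r' = s' := Fin.ext (by omega)
    exact σ.row_decreasing r' a' b' (by omega)
  first_col_increasing := by
    intro r s a b hrs h0 h0'
    -- The row `s` is not the top one, so if it is row `i` its part is at least 2 and its last cell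
    -- is outside the first column.
    have hb : (⟨s, b⟩ : CompCell α) ≠ lastCell α i := by
      intro hb
      have h1 : s = i := congrArg Sigma.fst hb
      subst h1
      have h2 : b.val = α.blocksFun s - 1 := by
        simp only [lastCell, Sigma.mk.injEq, heq_eq_eq, true_and] at hb
        rw [hb]
      have := α.blocks_pos' _ s.isLt
      rcases h with h | ⟨h, -⟩
      · omega
      · omega
    by_cases ha : (⟨r, a⟩ : CompCell α) = lastCell α i
    · rw [ha, extendEntry_lastCell, Fin.pos_iff_ne_zero, ← extendEntry_lastCell h σ.entry,
        Ne, EmbeddingLike.apply_eq_iff_eq]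
      exact hb
    obtain ⟨⟨r', a'⟩, hc⟩ := exists_remainingCell h ha
    obtain ⟨⟨s', b'⟩, hd⟩ := exists_remainingCell h hb
    rw [← hc, ← hd, extendEntry_remainingCell, extendEntry_remainingCell, Fin.succ_lt_succ_iff]
    have h1 : (remainingCell h ⟨r', a'⟩).1.val = r.val := by rw [hc]
    have h2 : (remainingCell h ⟨s', b'⟩).1.val = s.val := by rw [hd]
    have h3 : (remainingCell h ⟨r', a'⟩).2.val = a.val := by rw [hc]
    have h4 : (remainingCell h ⟨s', b'⟩).2.val = b.val := by rw [hd]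
    simp only [remainingCell] at h1 h2 h3 h4
    exact σ.first_col_increasing r' s' a' b' (by omega) (by omega) (by omega)
  triple := by
    intro r s a b hrs hab hlt
    have ha : (⟨r, a⟩ : CompCell α) ≠ lastCell α i := by
      intro ha
      rw [ha, extendEntry_lastCell] at hlt
      exact absurd hlt (Fin.not_lt_zero _)
    by_cases hb : (⟨s, b⟩ : CompCell α) = lastCell α i
    · have h1 : s = i := congrArg Sigma.fst hb
      subst h1
      have h2 : b.val = α.blocksFun s - 1 := by
        simp only [lastCell, Sigma.mk.injEq, heq_eq_eq, true_and] at hb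
        rw [hb]
      -- If row `r` ended at `a`, its length would be one less than that of the lower row `s`, which
      -- removability forbids.
      have h3 : a.val + 1 < α.blocksFun r := by
        have hr := a.isLt
        rcases h with h | ⟨-, h⟩
        · omega
        · by_contra h4
          exact h ⟨r, hrs, by omega⟩
      refine ⟨⟨a.val + 1, h3⟩, rfl, ?_⟩
      rw [hb, extendEntry_lastCell, Fin.pos_iff_ne_zero, ← extendEntry_lastCell h σ.entry,
        Ne, EmbeddingLike.apply_eq_iff_eq]
      intro hc
      exact hrs.ne (congrArg Sigma.fst hc)
    obtain ⟨⟨r', a'⟩, hc⟩ := exists_remainingCell h ha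
    obtain ⟨⟨s', b'⟩, hd⟩ := exists_remainingCell h hb
    have h1 : (remainingCell h ⟨r', a'⟩).1.val = r.val := by rw [hc]
    have h2 : (remainingCell h ⟨s', b'⟩).1.val = s.val := by rw [hd]
    have h3 : (remainingCell h ⟨r', a'⟩).2.val = a.val := by rw [hc]
    have h4 : (remainingCell h ⟨s', b'⟩).2.val = b.val := by rw [hd]
    rw [← hc, ← hd, extendEntry_remainingCell, extendEntry_remainingCell,
      Fin.succ_lt_succ_iff] at hlt
    simp only [remainingCell] at h1 h2 h3 h4
    obtain ⟨c', hc', hlt'⟩ := σ.triple r' s' a' b' (by omega) (by omega) hlt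
    obtain rfl : (remainingCell h ⟨r', c'⟩).1 = r := Fin.ext h1
    refine ⟨(remainingCell h ⟨r', c'⟩).2, by simp only [remainingCell]; omega, ?_⟩
    rw [← hd, extendEntry_remainingCell]
    refine lt_of_lt_of_eq ?_ (extendEntry_remainingCell h σ.entry ⟨r', c'⟩).symm
    exact Fin.succ_lt_succ_iff.2 hlt'

theorem extend_lastCell {α : Composition (n + 1)} {i : Fin α.length}
    (h : HasRemovableNode α i) (σ : SRCT (removeLastCell α i)) :
    (extend h σ).entry (lastCell α i) = 0 :=
  extendEntry_lastCell h σ.entry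

theorem extend_remainingCell {α : Composition (n + 1)} {i : Fin α.length}
    (h : HasRemovableNode α i) (σ : SRCT (removeLastCell α i))
    (c : CompCell (removeLastCell α i)) :
    (extend h σ).entry (remainingCell h c) = (σ.entry c).succ :=
  extendEntry_remainingCell h σ.entry c

theorem extend_injective {α : Composition (n + 1)} {i : Fin α.length}
    (h : HasRemovableNode α i) : Function.Injective (extend h) := by
  intro σ ρ hσρ
  apply SRCT.ext
  ext c : 1
  apply Fin.succ_injective
  rw [← extend_remainingCell h, ← extend_remainingCell h, hσρ]

/-- The remaining cells use up all nonzero values, so by bijectivity the last cell must contain `0`.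
-/
theorem eq_extend {α : Composition (n + 1)} {i : Fin α.length} (h : HasRemovableNode α i)
    {τ : SRCT α} {σ : SRCT (removeLastCell α i)}
    (hτ : ∀ c, τ.entry (remainingCell h c) = (σ.entry c).succ) : τ = extend h σ := by
  apply SRCT.ext
  ext c : 1
  by_cases hc : c = lastCell α i
  · rw [hc, extend_lastCell]
    by_contra h0
    obtain ⟨v, hv⟩ := Fin.exists_succ_eq.2 h0
    have := hτ (σ.entry.symm v)
    rw [Equiv.apply_symm_apply, hv, EmbeddingLike.apply_eq_iff_eq] at this
    exact remainingCell_ne_lastCell h _ this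
  · obtain ⟨d, rfl⟩ := exists_remainingCell h hc
    rw [hτ, extend_remainingCell]

/-- The smallest entry is in the last cell of its row. -/
theorem eq_lastCell_of_entry_eq_zero {α : Composition (n + 1)} {τ : SRCT α} {c : CompCell α}
    (hc : τ.entry c = 0) : c = lastCell α c.1 := by
  obtain ⟨r, a⟩ := c
  by_contra hne
  have hlt : a < (lastCell α r).2 := by
    have h1 : a.val ≠ α.blocksFun r - 1 := fun h => hne (CompCell.ext_val rfl h)
    have h2 := a.isLt
    change a.val < α.blocksFun r - 1
    omega
  have := τ.row_decreasing r a _ hlt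
  rw [hc] at this
  exact absurd this (Fin.not_lt_zero _)

/-- The row with the smallest entry has a removable node. -/
theorem hasRemovableNode_of_entry_eq_zero {α : Composition (n + 1)} {τ : SRCT α}
    {i : Fin α.length} (h : τ.entry (lastCell α i) = 0) : HasRemovableNode α i := by
  rcases Nat.eq_zero_or_pos i.val with h0 | h0
  · exact Or.inl h0
  have hpos : 0 < α.blocksFun i := α.blocks_pos' _ _
  refine Or.inr ⟨?_, ?_⟩
  · by_contra h1
    -- With a part of size 1, the smallest entry would lie in the first column below a smaller one.
    have hz := τ.first_col_increasing ⟨0, by omega⟩ i ⟨0, α.blocks_pos' _ _⟩ (lastCell α i).2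
      (Fin.lt_def.2 h0) rfl (by simp only [lastCell]; omega)
    rw [show (⟨i, (lastCell α i).2⟩ : CompCell α) = lastCell α i from rfl, h] at hz
    exact absurd hz (Fin.not_lt_zero _)
  · rintro ⟨j, hj, hji⟩
    have hposj : 0 < α.blocksFun j := α.blocks_pos' _ _
    -- The last cells of rows `j` and `i` are in adjacent columns, so the triple rule yields a cell
    -- past the end of row `j`.
    obtain ⟨c, hc, -⟩ := τ.triple j i (lastCell α j).2 (lastCell α i).2 hj
      (by simp only [lastCell]; omega) (by
        rw [show (⟨i, (lastCell α i).2⟩ : CompCell α) = lastCell α i from rfl, h,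
          Fin.pos_iff_ne_zero, ← h, Ne, EmbeddingLike.apply_eq_iff_eq]
        intro hc
        exact hj.ne (congrArg Sigma.fst hc))
    have := c.isLt
    simp only [lastCell] at hc
    omega

/-- Every tableau with the smallest entry at the end of row `i` arises by extension. -/
theorem exists_extend_eq {α : Composition (n + 1)} {i : Fin α.length} (h : HasRemovableNode α i)
    {τ : SRCT α} (h0 : τ.entry (lastCell α i) = 0) : ∃ σ, extend h σ = τ := by
  -- On both sides `none` stands for what is deleted: the last cell and the value `0`. By `h0` the
  -- equivalence matches them, so its restriction lowers every other entry by one.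
  let e : CompCell (removeLastCell α i) ≃ Fin n :=
    Equiv.removeNone ((optionCellEquiv h).trans (τ.entry.trans (finSuccEquiv n)))
  have he : ∀ c, τ.entry (remainingCell h c) = (e c).succ := by
    intro c
    have hne : τ.entry (remainingCell h c) ≠ 0 := by
      rw [← h0, Ne, EmbeddingLike.apply_eq_iff_eq]
      exact remainingCell_ne_lastCell h c
    obtain ⟨v, hv⟩ := Fin.exists_succ_eq.2 hne
    have := Equiv.removeNone_some ((optionCellEquiv h).trans (τ.entry.trans (finSuccEquiv n)))
      (x := c) ⟨v, by
        change finSuccEquiv n (τ.entry (remainingCell h c)) = _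
        rw [← hv, finSuccEquiv_succ]⟩
    change some (e c) = finSuccEquiv n (τ.entry (remainingCell h c)) at this
    rw [← hv, finSuccEquiv_succ, Option.some_inj] at this
    rw [← hv, this]
  have hlt : ∀ c d, e c < e d ↔ τ.entry (remainingCell h c) < τ.entry (remainingCell h d) := by
    intro c d
    rw [he, he, Fin.succ_lt_succ_iff]
  refine ⟨⟨e, ?_, ?_, ?_⟩, (eq_extend h he).symm⟩
  · intro r a b hab
    rw [hlt]
    exact τ.row_decreasing _ _ _ hab
  · intro r s a b hrs ha hb
    rw [hlt]
    exact τ.first_col_increasing _ _ _ _ (by simp only [Fin.lt_def] at *; omega) ha hb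
  · intro r s a b hrs hab hba
    rw [hlt] at hba
    obtain ⟨c, hc, hlt'⟩ := τ.triple (remainingCell h ⟨r, a⟩).1 (remainingCell h ⟨s, b⟩).1 _ _
      (by simp only [remainingCell, Fin.lt_def] at *; omega) hab hba
    -- The cell given by the triple rule in `τ` survives the deletion, since its entry exceeds
    -- another one.
    have hne : (⟨_, c⟩ : CompCell α) ≠ lastCell α i := by
      intro hl
      rw [hl, h0] at hlt'
      exact absurd hlt' (Fin.not_lt_zero _)
    obtain ⟨⟨r', c'⟩, hd⟩ := exists_remainingCell h hne
    have h1 : (remainingCell h ⟨r', c'⟩).1.val = (remainingCell h ⟨r, a⟩).1.val := by rw [hd]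
    have h2 : (remainingCell h ⟨r', c'⟩).2.val = c.val := by rw [hd]
    simp only [remainingCell] at h1 h2 hc
    obtain rfl : r' = r := Fin.ext (by omega)
    refine ⟨c', by omega, ?_⟩
    rw [hlt, hd]
    exact hlt'

end SRCT
end NodeRemoval

/-! ### Compatibility with the Hecke action -/

namespace SRCT
variable {n : ℕ}

theorem symm_extend_succ {α : Composition (n + 1)} {i : Fin α.length}
    (h : HasRemovableNode α i) (σ : SRCT (removeLastCell α i)) (v : Fin n) :
    (extend h σ).entry.symm v.succ = remainingCell h (σ.entry.symm v) := by
  rw [Equiv.symm_apply_eq, extend_remainingCell, Equiv.apply_symm_apply]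

theorem col_extend {α : Composition (n + 1)} {i : Fin α.length}
    (h : HasRemovableNode α i) (σ : SRCT (removeLastCell α i)) (v : Fin n) :
    (extend h σ).col v.succ = σ.col v := by
  unfold col
  rw [symm_extend_succ]
  rfl

theorem row_extend {α : Composition (n + 1)} {i : Fin α.length}
    (h : HasRemovableNode α i) (σ : SRCT (removeLastCell α i)) (v : Fin n) :
    (extend h σ).row v.succ = σ.row v + deletedRows α i := by
  unfold row
  rw [symm_extend_succ]
  rfl

theorem isDescent_extend {α : Composition (n + 1)} {i : Fin α.length}
    (h : HasRemovableNode α i) (σ : SRCT (removeLastCell α i)) (j : Fin (n - 1)) :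
    (extend h σ).IsDescent ⟨j.val + 1, by omega⟩ ↔ σ.IsDescent j := by
  unfold IsDescent
  rw [← col_extend h σ, ← col_extend h σ]
  rfl

/-- Columns are unchanged and both rows shift by `deletedRows α i`, so their comparison is
unaffected. -/
theorem attacking_extend {α : Composition (n + 1)} {i : Fin α.length}
    (h : HasRemovableNode α i) (σ : SRCT (removeLastCell α i)) (j : Fin (n - 1)) :
    (extend h σ).Attacking ⟨j.val + 1, by omega⟩ ↔ σ.Attacking j := by
  unfold Attacking
  rw [← col_extend h σ, ← col_extend h σ,
    ← Nat.add_lt_add_iff_right (k := deletedRows α i) (n := σ.row (lo j)),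
    ← row_extend h σ, ← row_extend h σ]
  rfl

/-- Both operators fall into the same case of the definition, and in the interchange case the two
exchanged values are successors, so the entry `0` stays put. -/
theorem piOp_extend {α : Composition (n + 1)} {i : Fin α.length}
    (h : HasRemovableNode α i) (σ : SRCT (removeLastCell α i)) (j : Fin (n - 1)) :
    piOp α ⟨j.val + 1, by omega⟩ (Finsupp.single (extend h σ) 1) =
      Finsupp.mapDomain (extend h) (piOp _ j (Finsupp.single σ 1)) := by
  by_cases hd : σ.IsDescent j
  · by_cases ha : σ.Attacking j
    · rw [piOp_of_attacking ha, piOp_of_attacking ((attacking_extend h σ j).2 ha),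
        Finsupp.mapDomain_zero]
    · rw [piOp_of_flip hd ha, piOp_of_flip ((isDescent_extend h σ j).2 hd)
        (mt (attacking_extend h σ j).1 ha), Finsupp.mapDomain_single]
      congr 1
      apply eq_extend
      intro c
      change Equiv.swap (lo j).succ (hi j).succ ((extend h σ).entry (remainingCell h c)) =
        (Equiv.swap (lo j) (hi j) (σ.entry c)).succ
      rw [extend_remainingCell, (Fin.succ_injective n).map_swap]
  · have hlt : σ.col (hi j) < σ.col (lo j) := by unfold IsDescent at hd; omega
    rw [piOp_of_lt hlt, Finsupp.mapDomain_single, piOp_of_lt]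
    have := mt (isDescent_extend h σ j).1 hd
    unfold IsDescent at this
    omega

/-- A linear map which intertwines the generators intertwines the actions of `H_n(0)`. -/
theorem map_rep {α : Composition (n + 1)} {β : Composition n}
    (F : (SRCT β →₀ ℂ) →ₗ[ℂ] (SRCT α →₀ ℂ))
    (hF : ∀ (j : Fin (n - 1)) x, F (piOp β j x) = piOp α ⟨j.val + 1, by omega⟩ (F x))
    (t : HeckeZero n) (x : SRCT β →₀ ℂ) :
    F (rep β t x) = rep α (HeckeZero.shift n t) (F x) := by
  obtain ⟨a, rfl⟩ := RingQuot.mkAlgHom_surjective ℂ (HeckeZero.Rel n) t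
  induction a using FreeAlgebra.induction generalizing x with
  | grade0 c =>
    simp only [AlgHom.commutes, Module.algebraMap_end_apply, map_smul]
  | grade1 j =>
    change F (rep β (HeckeZero.T j) x) = rep α (HeckeZero.shift n (HeckeZero.T j)) (F x)
    rw [HeckeZero.shift_T, rep, rep, HeckeZero.lift_T, HeckeZero.lift_T, hF]
  | mul a b ha hb => simp only [map_mul, Module.End.mul_apply, ha, hb]
  | add a b ha hb => simp only [map_add, LinearMap.add_apply, ha, hb]

/-! ### Assembling the direct sum -/

/-- The tableaux of shape `α⁻` correspond to the tableaux of shape `α` with the smallest entry in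
the removed cell, and this correspondence intertwines the operators `π_j` and `π_{j+1}`. -/
theorem exists_extension_map {α : Composition (n + 1)} {β : Composition n}
    (hβ : IsNodeRemoval α β) :
    ∃ g : SRCT β → SRCT α, Function.Injective g ∧
      (∃ i : Fin α.length, HasRemovableNode α i ∧ β = removeLastCell α i ∧
        ∀ τ, τ ∈ Set.range g ↔ τ.entry (lastCell α i) = 0) ∧
      ∀ (j : Fin (n - 1)) (x : SRCT β →₀ ℂ),
        Finsupp.lmapDomain ℂ ℂ g (piOp β j x) =
          piOp α ⟨j.val + 1, by omega⟩ (Finsupp.lmapDomain ℂ ℂ g x) := by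
  -- Stating the result for a variable `β` confines the substitution of `removeLastCell α i` to this
  -- place; no transport of tableaux along equalities of compositions is needed later.
  obtain ⟨i, h, rfl⟩ := hβ
  refine ⟨extend h, extend_injective h, ⟨i, h, rfl, fun τ => ⟨?_, exists_extend_eq h⟩⟩, ?_⟩
  · rintro ⟨σ, rfl⟩
    exact extend_lastCell h σ
  · intro j
    refine LinearMap.congr_fun (f := (Finsupp.lmapDomain ℂ ℂ (extend h)) ∘ₗ piOp _ j)
      (g := piOp α ⟨j.val + 1, by omega⟩ ∘ₗ Finsupp.lmapDomain ℂ ℂ (extend h)) ?_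
    refine Finsupp.lhom_ext' fun σ => LinearMap.ext_ring ?_
    simp only [LinearMap.comp_apply, Finsupp.lsingle_apply, Finsupp.lmapDomain_apply,
      Finsupp.mapDomain_single, piOp_extend]

/-- The position of the entry `0` in a tableau determines the row, hence the summand, from which it
comes. -/
theorem bijective_sigma_of_extension_maps {α : Composition (n + 1)}
    (g : ∀ β : {β : Composition n // IsNodeRemoval α β}, SRCT β.1 → SRCT α)
    (hg : ∀ β, Function.Injective (g β))
    (hr : ∀ β, ∃ i : Fin α.length, HasRemovableNode α i ∧ β.1 = removeLastCell α i ∧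
      ∀ τ, τ ∈ Set.range (g β) ↔ τ.entry (lastCell α i) = 0) :
    Function.Bijective fun s : Σ β : {β : Composition n // IsNodeRemoval α β}, SRCT β.1 =>
      g s.1 s.2 := by
  constructor
  · rintro ⟨β, σ⟩ ⟨γ, ρ⟩ heq
    simp only at heq
    obtain ⟨i, -, hβ, hi⟩ := hr β
    obtain ⟨j, -, hγ, hj⟩ := hr γ
    have h1 := (hi _).1 ⟨σ, rfl⟩
    have h2 := (hj _).1 ⟨ρ, rfl⟩
    rw [heq, ← h2, EmbeddingLike.apply_eq_iff_eq] at h1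
    obtain rfl : i = j := congrArg Sigma.fst h1
    obtain rfl : β = γ := Subtype.ext (hβ.trans hγ.symm)
    rw [hg β heq]
  · intro τ
    have h0 := eq_lastCell_of_entry_eq_zero (τ.entry.apply_symm_apply 0)
    set i := (τ.entry.symm 0).1
    have hτ : τ.entry (lastCell α i) = 0 := by rw [← h0, Equiv.apply_symm_apply]
    have hi := hasRemovableNode_of_entry_eq_zero hτ
    obtain ⟨j, hj, hβ, hjr⟩ := hr ⟨_, i, hi, rfl⟩
    -- The row `j` attached to this composition could a priori differ from the row `i` containing
    -- `0`.
    obtain rfl := removeLastCell_inj hi hj hβ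
    obtain ⟨σ, hσ⟩ := (hjr τ).2 hτ
    exact ⟨⟨_, σ⟩, hσ⟩

end SRCT

open scoped DirectSum in
theorem corollary9p10 (n : ℕ) (α : Composition (n + 1)) :
    Nonempty (QSchurModuleRes α ≃ₗ[HeckeZero n]
      ⨁ β : {β : Composition n // IsNodeRemoval α β}, QSchurModule β.1) := by
  classical
  choose g hg hr hpi using fun β : {β : Composition n // IsNodeRemoval α β} =>
    SRCT.exists_extension_map β.2
  let E := Equiv.ofBijective _ (SRCT.bijective_sigma_of_extension_maps g hg hr)
  let f (β : {β : Composition n // IsNodeRemoval α β}) :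
      QSchurModule β.1 →ₗ[HeckeZero n] QSchurModuleRes α :=
    { toFun := fun x => Finsupp.lmapDomain ℂ ℂ (g β) x
      map_add' := fun x y => map_add (Finsupp.lmapDomain ℂ ℂ (g β)) x y
      map_smul' := fun t x => SRCT.map_rep (Finsupp.lmapDomain ℂ ℂ (g β)) (hpi β) t x }
  let F := DirectSum.toModule (HeckeZero n) _ (QSchurModuleRes α) f
  -- `F` is Hecke-linear by construction, while `Ψ`, induced by the bijection `E` of bases, is
  -- visibly bijective but only `ℂ`-linear. Their agreement on basis vectors gives both properties
  -- at once.
  let Ψ : (Π₀ β : {β : Composition n // IsNodeRemoval α β}, SRCT β.1 →₀ ℂ) ≃ₗ[ℂ]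
      (SRCT α →₀ ℂ) :=
    (sigmaFinsuppLequivDFinsupp ℂ).symm ≪≫ₗ Finsupp.domLCongr E
  let Ψ' : (⨁ β : {β : Composition n // IsNodeRemoval α β}, QSchurModule β.1) →+
      QSchurModuleRes α := Ψ.toLinearMap.toAddMonoidHom
  have hΨ : F.toAddMonoidHom = Ψ' := by
    refine DirectSum.addHom_ext fun β x => ?_
    have h1 : F (DirectSum.of (fun β : {β : Composition n // IsNodeRemoval α β} =>
        QSchurModule β.1) β x) = f β x := DirectSum.toModule_lof _ _ _
    refine h1.trans ?_
    change Finsupp.lmapDomain ℂ ℂ (g β) x = (Ψ.toLinearMap ∘ₗ DFinsupp.lsingle β) x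
    refine LinearMap.congr_fun (Finsupp.lhom_ext' fun σ => LinearMap.ext_ring ?_) x
    simp only [LinearMap.comp_apply, Finsupp.lsingle_apply, Finsupp.lmapDomain_apply,
      Finsupp.mapDomain_single]
    have h2 : (sigmaFinsuppLequivDFinsupp ℂ).symm (DFinsupp.single β (Finsupp.single σ (1 : ℂ))) =
        Finsupp.single (⟨β, σ⟩ : Σ β : {β : Composition n // IsNodeRemoval α β}, SRCT β.1) 1 := by
      rw [LinearEquiv.symm_apply_eq]
      exact (sigmaFinsuppEquivDFinsupp_single
        (⟨β, σ⟩ : Σ β : {β : Composition n // IsNodeRemoval α β}, SRCT β.1) (1 : ℂ)).symm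
    change _ = Finsupp.domLCongr (R := ℂ) (M := ℂ) E ((sigmaFinsuppLequivDFinsupp ℂ).symm
      (DFinsupp.single β (Finsupp.single σ (1 : ℂ))))
    rw [h2, Finsupp.domLCongr_single]
    rfl
  have hF : Function.Bijective F := by
    have : Function.Bijective F.toAddMonoidHom := hΨ ▸ Ψ.bijective
    exact this
  exact ⟨(LinearEquiv.ofBijective F hF).symm⟩
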